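/- Let $\Omega\subset\mathbb R^d$ be bounded, let $\tau>d/2$ and $\sigma\in(\tfrac{d}{2\tau},1]$. Let $k(x,z)=\Phi(x-z)$ and $k^{(\sigma)}(x,z)=\Phi^{(\sigma)}(x-z)$ be the translation invariant kernels on $\Omega$ given by continuous integrable functions $\Phi,\Phi^{(\sigma)}:\mathbb R^d\to\mathbb R$ with Fourier transforms $\hat\Phi(\omega)=(1+\|\omega\|^2)^{-\tau}$ and $\hat\Phi^{(\sigma)}(\omega)=(1+\|\omega\|^2)^{-\sigma\tau}$ for all $\omega\in\mathbb R^d$, where $\hat f(\omega)=(2\pi)^{-d/2}\int_{\mathbb R^d} f(x)e^{-i\omega^\top x}\,\mathrm dx$. Then there is a constant $c'_\sigma>0$, depending only on $\sigma,d,\tau,\Omega$, with the following property. Let $C,C_1>0$ and let $\tilde k,\tilde k^{(\sigma)}$ be (symmetric, positive semidefinite) kernels on $\Omega$ that are norm-equivalent to $k$ and $k^{(\sigma)}$ respectively: the reproducing kernel Hilbert spaces satisfy $\mathcal H_{\tilde k}(\Omega)=\mathcal H_k(\Omega)$ and $\mathcal H_{\tilde k^{(\sigma)}}(\Omega)=\mathcal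 H_{k^{(\sigma)}}(\Omega)$ as sets of functions, and their norms satisfy $$C^{-1}\|\cdot\|_{\mathcal H_k(\Omega)}\le\|\cdot\|_{\mathcal H_{\tilde k}(\Omega)}\le C\,\|\cdot\|_{\mathcal H_k(\Omega)},\qquad C_1^{-1}\|\cdot\|_{\mathcal H_{k^{(\sigma)}}(\Omega)}\le\|\cdot\|_{\mathcal H_{\tilde k^{(\sigma)}}(\Omega)}\le C_1\|\cdot\|_{\mathcal H_{k^{(\sigma)}}(\Omega)}.$$ Let $X=\{x_1,\dots,x_n\}\subset\Omega$ be $n\ge 2$ pairwise distinct points with separation distance $q_X=\min_{i\ne j}\|x_i-x_j\|$, and let $\tilde A=(\tilde k(x_i,x_j))_{i,j}$ and $\tilde A^{(\sigma)}=(\tilde k^{(\sigma)}(x_i,x_j))_{i,j}$. Then $\tilde A$ is positive definite, the minimum and maximum below exist, and $$C_1^{-2}C^{-2}\le\min_{0\ne\alpha\in\mathbb R^{n}}\frac{\alpha^\top\tilde A^{(\sigma)}\alpha}{\alpha^\top\tilde A\alpha}\le\max_{0\ne\alpha\in\mathbb R^{n}}\frac{\alpha^\top\tilde A^{(\sigma)}\alpha}{\alpha^\top\tilde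 A\alpha}\le C_1^2C^2\,c'_\sigma\,q_X^{-2(1-\sigma)\tau}.$$ Furthermore, the eigenvalues $\lambda_1\le\dots\le\lambda_n$ of $\tilde A$ and of $\tilde A^{(\sigma)}$, listed in increasing order with multiplicity, satisfy for every $i=1,\dots,n$ $$C_1^{-2}C^{-2}\,\lambda_i(\tilde A)\le\lambda_i(\tilde A^{(\sigma)})\le C_1^2C^2\,c'_\sigma\,q_X^{-2(1-\sigma)\tau}\,\lambda_i(\tilde A).$$ -/

import Mathlib

open Real MeasureTheory Matrix

noncomputable section

/-- A (real-valued, symmetric, positive semidefinite) kernel on a set `S`: a function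
`S × S → ℝ`, all of whose finite kernel matrices are positive semidefinite. -/
structure PDKernel (S : Type*) where
  /-- the values `k x z` of the kernel -/
  val : Matrix S S ℝ
  posSemidef : val.PosSemidef

namespace PDKernel

variable {S : Type*}

/-- The kernel with each real value `k x z` read as the operator `t ↦ k x z * t` on `ℝ`; this is
the form in which Mathlib's theory of reproducing kernel Hilbert spaces takes kernels. -/
def op (k : PDKernel S) : Matrix S S (ℝ →L[ℝ] ℝ) :=
  Matrix.of fun x z => k.val x z • (1 : ℝ →L[ℝ] ℝ)

theorem posSemidef_op (k : PDKernel S) : k.op.PosSemidef := by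
  refine ((RKHS.posSemidef_tfae (K := k.op)).out 0 2 rfl rfl).mpr ⟨?_, fun v => ?_⟩
  · ext x z
    have h := k.posSemidef.isHermitian.apply x z
    simp only [star_trivial] at h
    simp [op, Matrix.conjTranspose_apply, h]
  · have h := k.posSemidef.2 v
    rw [Finsupp.sum_comm] at h
    convert! h using 1
    simp only [Finsupp.sum, RCLike.re_to_real]
    refine Finset.sum_congr rfl fun x _ => Finset.sum_congr rfl fun z _ => ?_
    simp [op]
    ring

instance (k : PDKernel S) : Fact k.op.PosSemidef := ⟨k.posSemidef_op⟩

/-- The reproducing kernel Hilbert space of the kernel `k`, a Hilbert space of functions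
`S → ℝ` (Mathlib's Moore–Aronszajn construction). -/
abbrev Space (k : PDKernel S) : Type _ := RKHS.OfKernel k.op

/-- `k` and `k'` are norm-equivalent with constant `C`: their reproducing kernel Hilbert spaces
coincide as sets of functions, and `C⁻¹ ‖f‖_k ≤ ‖f‖_{k'} ≤ C ‖f‖_k` for every such function. -/
def NormEquivalent (k k' : PDKernel S) (C : ℝ) : Prop :=
  Set.range (fun f : k.Space => (⇑f : S → ℝ)) = Set.range (fun g : k'.Space => (⇑g : S → ℝ)) ∧
    ∀ (f : k.Space) (g : k'.Space), (⇑f : S → ℝ) = ⇑g → C⁻¹ * ‖f‖ ≤ ‖g‖ ∧ ‖g‖ ≤ C * ‖f‖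

/-- The kernel matrix `k(X, X)` of the points `x 0, …, x (n - 1)`. -/
def matrix (k : PDKernel S) {n : ℕ} (x : Fin n → S) : Matrix (Fin n) (Fin n) ℝ :=
  k.val.submatrix x x

theorem isHermitian_matrix (k : PDKernel S) {n : ℕ} (x : Fin n → S) : (k.matrix x).IsHermitian :=
  k.posSemidef.isHermitian.submatrix x

/-- The eigenvalues of the kernel matrix, with multiplicity, in increasing order:
`k.eigenvalue x 0 ≤ … ≤ k.eigenvalue x (n - 1)` (Mathlib's `eigenvalues₀` is decreasing). -/
def eigenvalue (k : PDKernel S) {n : ℕ} (x : Fin n → S) (i : Fin n) : ℝ :=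
  (k.isHermitian_matrix x).eigenvalues₀ (Fin.cast (Fintype.card_fin n).symm i.rev)

/-- `k` (a kernel on a subset of `ℝ^d`) is the translational invariant kernel
`k(x, z) = Φ(x - z)`. -/
def IsTranslationInvariant {d : ℕ} {Ω : Set (EuclideanSpace ℝ (Fin d))} (k : PDKernel Ω)
    (Φ : EuclideanSpace ℝ (Fin d) → ℝ) : Prop :=
  ∀ x z : Ω, k.val x z = Φ ((x : EuclideanSpace ℝ (Fin d)) - z)

end PDKernel

/-- The Fourier transform `(2π)^(-d/2) ∫ Φ(x) exp(-i ⟨ω, x⟩) dx` on `ℝ^d`. -/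
def fourierHat {d : ℕ} (Φ : EuclideanSpace ℝ (Fin d) → ℝ) (ω : EuclideanSpace ℝ (Fin d)) : ℂ :=
  (((2 * π) ^ (-(d : ℝ) / 2) : ℝ) : ℂ) *
    ∫ x, (Φ x : ℂ) * Complex.exp (-(Complex.I * ((inner ℝ ω x : ℝ) : ℂ)))

/-- `Φ` is the continuous integrable function on `ℝ^d` with Fourier transform
`(1 + ‖ω‖²)^(-s)`. -/
structure IsSobolevFunction {d : ℕ} (Φ : EuclideanSpace ℝ (Fin d) → ℝ) (s : ℝ) : Prop where
  continuous : Continuous Φ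
  integrable : Integrable Φ
  fourierHat_eq : ∀ ω, fourierHat Φ ω = (((1 + ‖ω‖ ^ 2) ^ (-s) : ℝ) : ℂ)

/-- The separation distance `min_{i ≠ j} ‖x i - x j‖` of pairwise distinct points (at least two). -/
def sepDist {d n : ℕ} (x : Fin n → EuclideanSpace ℝ (Fin d)) : ℝ :=
  (Set.range x).infsep

/-- The quotients `αᵀ B α / αᵀ A α` over all nonzero vectors `α`. -/
def rayleighQuotients {n : ℕ} (B A : Matrix (Fin n) (Fin n) ℝ) : Set ℝ :=
  {r | ∃ α : Fin n → ℝ, α ≠ 0 ∧ r = (α ⬝ᵥ (B *ᵥ α)) / (α ⬝ᵥ (A *ᵥ α))}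

end

/-! For a translation invariant kernel whose Fourier weight has order `s`, the form αᵀAα equals
(2π)^(d/2) ∫ w_s |T|², where w_s is `besselWeight s` and T is the trigonometric sum `trigSum x α`
(`quadForm_eq`). The theorem thus compares two weighted integrals of the same |T|². Since w_τ ≤
w_{στ} pointwise, the lower bound for the unperturbed kernels has constant 1.

For the upper bound, frequencies are cut at size about 1/q (`besselWeight_le_add`). Below the cut,
w_{στ} ≲ q^(-2(1-σ)τ) w_τ. Above it, w_{στ}(ξ) ≲ q^(2στ) w_{στ}(qξ), and ∫ w_{στ}(qξ) |T|² ≲ q^(-d)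
|α|²; this is absorbed by the stability bound q^(2τ-d) |α|² ≲ ∫ w_τ |T|². Both estimates use one
function h ≥ 0 whose inverse Fourier transform vanishes where ‖y‖ ≥ 1: against h(qξ - η) all cross
terms of |T|² integrate to zero, which leaves the same multiple of q^(-d) |α|² for every η.

Norm equivalence of native spaces becomes equivalence of quadratic forms with the constant squared
(`quadForm_le_of_forall_exists_norm_le`). The resulting form inequalities bound the Rayleigh
quotients directly and the eigenvalues by Courant-Fischer. -/

noncomputable section

/-! ### Ordered eigenvalues and extremal Rayleigh quotients -/

section Eigenvalues

variable {E : Type*} [NormedAddCommGroup E] [InnerProductSpace ℝ E] [FiniteDimensional ℝ E]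

theorem LinearMap.IsSymmetric.inner_apply_self_eq_sum {T : E →ₗ[ℝ] E} (hT : T.IsSymmetric) {n : ℕ}
    (hn : Module.finrank ℝ E = n) (v : E) :
    inner ℝ v (T v) = ∑ j, hT.eigenvalues hn j * (inner ℝ (hT.eigenvectorBasis hn j) v) ^ 2 := by
  rw [← (hT.eigenvectorBasis hn).sum_inner_mul_inner]
  refine Finset.sum_congr rfl fun j _ => ?_
  have h := hT.eigenvectorBasis_apply_self_apply hn v j
  rw [OrthonormalBasis.repr_apply_apply, OrthonormalBasis.repr_apply_apply] at h
  rw [h, real_inner_comm]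
  simp
  ring

/-- Comparison of quadratic forms gives comparison of ordered eigenvalues (a consequence of the
Courant-Fischer principle). -/
theorem LinearMap.IsSymmetric.mul_eigenvalues_le {T S : E →ₗ[ℝ] E} (hT : T.IsSymmetric)
    (hS : S.IsSymmetric) {n : ℕ} (hn : Module.finrank ℝ E = n) {a b : ℝ} (ha : 0 ≤ a) (hb : 0 ≤ b)
    (hab : ∀ v, a * inner ℝ v (T v) ≤ b * inner ℝ v (S v)) (i : Fin n) :
    a * hT.eigenvalues hn i ≤ b * hS.eigenvalues hn i := by
  -- A kernel vector satisfies n - 1 conditions: it is orthogonal to the `T`-eigenvectors after `i`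
  -- and to the `S`-eigenvectors before `i`. As eigenvalues decrease, it bounds the `T`-form below
  -- and the `S`-form above by the `i`-th eigenvalues.
  let f : E →ₗ[ℝ] ({j : Fin n // j ≠ i} → ℝ) := LinearMap.pi fun j =>
    if i < j then (innerₛₗ ℝ (hT.eigenvectorBasis hn j)) else innerₛₗ ℝ (hS.eigenvectorBasis hn j)
  have hf : LinearMap.ker f ≠ ⊥ := by
    apply LinearMap.ker_ne_bot_of_finrank_lt
    have hi := i.2
    rw [hn, Module.finrank_fintype_fun_eq_card, Fintype.card_subtype_compl]
    simp
    omega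
  obtain ⟨v, hv, hv0⟩ := Submodule.exists_mem_ne_zero_of_ne_bot hf
  have hfv : ∀ j (hj : j ≠ i), f v ⟨j, hj⟩ = 0 := fun j hj => by
    rw [LinearMap.mem_ker.mp hv]; rfl
  have hvT : ∀ j, i < j → inner ℝ (hT.eigenvectorBasis hn j) v = 0 := fun j hj => by
    simpa [f, hj] using hfv j hj.ne'
  have hvS : ∀ j, j < i → inner ℝ (hS.eigenvectorBasis hn j) v = 0 := fun j hj => by
    simpa [f, hj.not_gt] using hfv j hj.ne
  have hlow : hT.eigenvalues hn i * ‖v‖ ^ 2 ≤ inner ℝ v (T v) := by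
    rw [hT.inner_apply_self_eq_sum hn, ← (hT.eigenvectorBasis hn).sum_sq_norm_inner_right,
      Finset.mul_sum]
    refine Finset.sum_le_sum fun j _ => ?_
    rcases lt_or_ge i j with hj | hj
    · simp [hvT j hj]
    · simp only [Real.norm_eq_abs, sq_abs]
      exact mul_le_mul_of_nonneg_right (hT.eigenvalues_antitone hn hj) (sq_nonneg _)
  have hup : inner ℝ v (S v) ≤ hS.eigenvalues hn i * ‖v‖ ^ 2 := by
    rw [hS.inner_apply_self_eq_sum hn, ← (hS.eigenvectorBasis hn).sum_sq_norm_inner_right,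
      Finset.mul_sum]
    refine Finset.sum_le_sum fun j _ => ?_
    rcases lt_or_ge j i with hj | hj
    · simp [hvS j hj]
    · simp only [Real.norm_eq_abs, sq_abs]
      exact mul_le_mul_of_nonneg_right (hS.eigenvalues_antitone hn hj) (sq_nonneg _)
  have hpos : 0 < ‖v‖ ^ 2 := by positivity
  have := (mul_le_mul_of_nonneg_left hlow ha).trans ((hab v).trans
    (mul_le_mul_of_nonneg_left hup hb))
  rw [← mul_assoc, ← mul_assoc] at this
  exact le_of_mul_le_mul_right this hpos

theorem Matrix.IsHermitian.mul_eigenvalues₀_le {ι : Type*} [Fintype ι] [DecidableEq ι]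
    {A B : Matrix ι ι ℝ} (hA : A.IsHermitian) (hB : B.IsHermitian) {a b : ℝ} (ha : 0 ≤ a)
    (hb : 0 ≤ b) (hab : ∀ v : ι → ℝ, a * (v ⬝ᵥ (A *ᵥ v)) ≤ b * (v ⬝ᵥ (B *ᵥ v)))
    (i : Fin (Fintype.card ι)) : a * hA.eigenvalues₀ i ≤ b * hB.eigenvalues₀ i := by
  refine LinearMap.IsSymmetric.mul_eigenvalues_le _ _ _ ha hb (fun v => ?_) i
  have h := hab v.ofLp
  simp only [EuclideanSpace.inner_eq_star_dotProduct, star_trivial, toLpLin_apply]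
  rw [dotProduct_comm, dotProduct_comm _ v.ofLp]
  exact h

end Eigenvalues

/-- The quotient is homogeneous of degree 0, so its values are those on the unit sphere, which is
compact and, since `0 < n`, nonempty. -/
theorem exists_isLeast_isGreatest_rayleighQuotients {n : ℕ} (hn : 0 < n)
    (B A : Matrix (Fin n) (Fin n) ℝ) (hA : ∀ α : Fin n → ℝ, α ≠ 0 → 0 < α ⬝ᵥ (A *ᵥ α)) :
    ∃ m M : ℝ, IsLeast (rayleighQuotients B A) m ∧ IsGreatest (rayleighQuotients B A) M := by
  have : NeZero n := ⟨hn.ne'⟩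
  have him : rayleighQuotients B A =
      (fun α : Fin n → ℝ => (α ⬝ᵥ (B *ᵥ α)) / (α ⬝ᵥ (A *ᵥ α))) '' Metric.sphere 0 1 := by
    ext r
    constructor
    · rintro ⟨α, hα, rfl⟩
      have hne : ‖α‖ ≠ 0 := norm_ne_zero_iff.mpr hα
      refine ⟨‖α‖⁻¹ • α, by simp [norm_smul, hne], ?_⟩
      simp only [mulVec_smul, smul_dotProduct, dotProduct_smul, smul_eq_mul]
      field_simp
    · rintro ⟨α, hα, rfl⟩
      refine ⟨α, ?_, rfl⟩
      rintro rfl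
      simp at hα
  have hcont : ContinuousOn (fun α : Fin n → ℝ => (α ⬝ᵥ (B *ᵥ α)) / (α ⬝ᵥ (A *ᵥ α)))
      (Metric.sphere 0 1) := by
    refine ContinuousOn.div (by fun_prop) (by fun_prop) fun α hα => (hA α ?_).ne'
    rintro rfl
    simp at hα
  have hcomp := (isCompact_sphere (0 : Fin n → ℝ) 1).image_of_continuousOn hcont
  have hne : (Metric.sphere (0 : Fin n → ℝ) 1).Nonempty :=
    NormedSpace.sphere_nonempty.mpr zero_le_one
  rw [him]
  obtain ⟨m, hm⟩ := hcomp.exists_isLeast (hne.image _)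
  obtain ⟨M, hM⟩ := hcomp.exists_isGreatest (hne.image _)
  exact ⟨m, M, hm, hM⟩

/-! ### From norm equivalence of native spaces to quadratic forms -/

namespace PDKernel

variable {S : Type*}

theorem kerFun_apply (k : PDKernel S) (x z : S) :
    RKHS.kerFun k.Space z (1 : ℝ) x = k.val x z := by
  rw [RKHS.kerFun_apply, RKHS.OfKernel.kernel_ofKernel]
  simp [op]

/-- The kernel interpolant `∑ α i • k(·, x i)` as an element of the native space. -/
def combination (k : PDKernel S) {n : ℕ} (x : Fin n → S) (α : Fin n → ℝ) : k.Space :=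
  ∑ i, α i • RKHS.kerFun k.Space (x i) (1 : ℝ)

theorem inner_combination (k : PDKernel S) {n : ℕ} (x : Fin n → S) (α : Fin n → ℝ)
    (f : k.Space) : inner ℝ f (k.combination x α) = ∑ i, α i * f (x i) := by
  simp [combination, inner_sum, inner_smul_right]

theorem combination_apply (k : PDKernel S) {n : ℕ} (x : Fin n → S) (α : Fin n → ℝ) (z : S) :
    k.combination x α z = ∑ i, k.val z (x i) * α i := by
  have h := RKHS.inner_kerFun z (1 : ℝ) (k.combination x α)
  rw [real_inner_comm, inner_combination] at h
  simp only [kerFun_apply] at h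
  rw [show inner ℝ (k.combination x α z) (1 : ℝ) = k.combination x α z by simp] at h
  rw [← h]
  refine Finset.sum_congr rfl fun i _ => ?_
  have := k.posSemidef.isHermitian.apply z (x i)
  simp only [star_trivial] at this
  rw [this, mul_comm]

theorem norm_combination_sq (k : PDKernel S) {n : ℕ} (x : Fin n → S) (α : Fin n → ℝ) :
    ‖k.combination x α‖ ^ 2 = α ⬝ᵥ (k.matrix x *ᵥ α) := by
  rw [← real_inner_self_eq_norm_sq, inner_combination]
  simp only [combination_apply, matrix, dotProduct, mulVec, submatrix_apply]

/-- A duality argument: the quadratic form is the squared norm of the functional f ↦ ∑ α i f(x i),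
and this functional sees only function values. An embedding with norm at most `C` therefore costs a
factor `C ^ 2`. -/
theorem quadForm_le_of_forall_exists_norm_le {k k' : PDKernel S} {C : ℝ} (hC : 0 ≤ C)
    (h : ∀ g : k'.Space, ∃ f : k.Space, (⇑f : S → ℝ) = ⇑g ∧ ‖f‖ ≤ C * ‖g‖)
    {n : ℕ} (x : Fin n → S) (α : Fin n → ℝ) :
    α ⬝ᵥ (k'.matrix x *ᵥ α) ≤ C ^ 2 * (α ⬝ᵥ (k.matrix x *ᵥ α)) := by
  rw [← norm_combination_sq, ← norm_combination_sq]
  set g := k'.combination x α with hg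
  obtain ⟨f, hfg, hf⟩ := h g
  -- By the reproducing property in either space, both sides are ∑ α i g(x i).
  have h1 : ‖g‖ ^ 2 = inner ℝ f (k.combination x α) := by
    rw [inner_combination, hfg, ← real_inner_self_eq_norm_sq]
    conv_lhs => rw [hg, inner_combination]
  have h2 : ‖g‖ ^ 2 ≤ C * ‖g‖ * ‖k.combination x α‖ :=
    h1.le.trans ((real_inner_le_norm _ _).trans (by gcongr))
  have h3 : ‖g‖ ≤ C * ‖k.combination x α‖ := by
    rcases (norm_nonneg g).eq_or_lt with h0 | h0
    · rw [← h0]; positivity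
    · refine le_of_mul_le_mul_left ?_ h0
      linarith
  calc ‖g‖ ^ 2 ≤ (C * ‖k.combination x α‖) ^ 2 := by gcongr
    _ = _ := by ring

theorem NormEquivalent.quadForm_le {k k' : PDKernel S} {C : ℝ} (hC : 0 < C)
    (h : k.NormEquivalent k' C) {n : ℕ} (x : Fin n → S) (α : Fin n → ℝ) :
    α ⬝ᵥ (k'.matrix x *ᵥ α) ≤ C ^ 2 * (α ⬝ᵥ (k.matrix x *ᵥ α)) := by
  refine quadForm_le_of_forall_exists_norm_le hC.le (fun g => ?_) x α
  obtain ⟨f, hf⟩ : (⇑g : S → ℝ) ∈ Set.range (fun f : k.Space => (⇑f : S → ℝ)) :=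
    h.1 ▸ Set.mem_range_self g
  refine ⟨f, hf, ?_⟩
  have := (h.2 f g hf).1
  rwa [inv_mul_le_iff₀ hC] at this

theorem NormEquivalent.quadForm_ge {k k' : PDKernel S} {C : ℝ} (hC : 0 < C)
    (h : k.NormEquivalent k' C) {n : ℕ} (x : Fin n → S) (α : Fin n → ℝ) :
    α ⬝ᵥ (k.matrix x *ᵥ α) ≤ C ^ 2 * (α ⬝ᵥ (k'.matrix x *ᵥ α)) := by
  refine quadForm_le_of_forall_exists_norm_le hC.le (fun f => ?_) x α
  obtain ⟨g, hg⟩ : (⇑f : S → ℝ) ∈ Set.range (fun g : k'.Space => (⇑g : S → ℝ)) :=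
    h.1 ▸ Set.mem_range_self f
  exact ⟨g, hg, (h.2 f g hg.symm).2⟩

end PDKernel

/-! ### Bessel weights, trigonometric sums and band-limited localizers -/

section Frequency

open scoped FourierTransform SchwartzMap

section Weight

variable {V : Type*} [NormedAddCommGroup V]

/-- The Fourier multiplier `(1 + ‖2πξ‖²)^(-s)`. -/
def besselWeight (s : ℝ) (ξ : V) : ℝ := (1 + (2 * π * ‖ξ‖) ^ 2) ^ (-s)

theorem besselWeight_pos (s : ℝ) (ξ : V) : 0 < besselWeight s ξ := by
  unfold besselWeight; positivity

/-- A Peetre-type inequality, from ‖η‖ ≤ ‖ζ‖ + r: the weight is comparable to itself on balls of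
fixed radius, uniformly in the centre. -/
theorem besselWeight_le_mul_of_dist_lt {s r : ℝ} (hs : 0 ≤ s) {ζ η : V} (hd : dist η ζ < r) :
    besselWeight s ζ ≤ (2 + 2 * (2 * π * r) ^ 2) ^ s * besselWeight s η := by
  have hn : ‖η‖ ≤ ‖ζ‖ + r := by
    have := norm_le_norm_add_norm_sub' η ζ
    rw [dist_eq_norm] at hd
    linarith
  have hbase : 1 + (2 * π * ‖η‖) ^ 2 ≤ (2 + 2 * (2 * π * r) ^ 2) * (1 + (2 * π * ‖ζ‖) ^ 2) := by
    have h1 : (2 * π * ‖η‖) ^ 2 ≤ (2 * π * ‖ζ‖ + 2 * π * r) ^ 2 := by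
      gcongr
      rw [← mul_add]
      gcongr
    nlinarith [sq_nonneg (2 * π * ‖ζ‖ - 2 * π * r), sq_nonneg (2 * π * ‖ζ‖),
      mul_nonneg (sq_nonneg (2 * π * ‖ζ‖)) (sq_nonneg (2 * π * r))]
  have h2 := rpow_le_rpow (by positivity) hbase hs
  rw [mul_rpow (by positivity) (by positivity)] at h2
  rw [besselWeight, besselWeight, rpow_neg (by positivity), rpow_neg (by positivity),
    ← div_eq_mul_inv, le_div_iff₀ (by positivity), inv_mul_le_iff₀ (by positivity)]
  linarith

theorem continuous_besselWeight (s : ℝ) : Continuous (besselWeight s : V → ℝ) := by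
  unfold besselWeight
  exact Continuous.rpow_const (by fun_prop) fun ξ => Or.inl (by positivity)

end Weight

variable {V : Type*} [NormedAddCommGroup V] [InnerProductSpace ℝ V]

/-- The trigonometric sum `ξ ↦ ∑ α j exp(2πi ⟨ξ, x j⟩)`. -/
def trigSum {n : ℕ} (x : Fin n → V) (α : Fin n → ℝ) (ξ : V) : ℂ :=
  ∑ j, (α j : ℂ) * ((𝐞 (inner ℝ ξ (x j)) : Circle) : ℂ)

theorem continuous_trigSum {n : ℕ} (x : Fin n → V) (α : Fin n → ℝ) : Continuous (trigSum x α) := by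
  unfold trigSum
  simp only [Real.fourierChar_apply]
  fun_prop

theorem norm_trigSum_le {n : ℕ} (x : Fin n → V) (α : Fin n → ℝ) (ξ : V) :
    ‖trigSum x α ξ‖ ≤ ∑ j, |α j| := by
  refine (norm_sum_le _ _).trans (Finset.sum_le_sum fun j _ => ?_)
  rw [norm_mul, Circle.norm_coe, mul_one, Complex.norm_real, Real.norm_eq_abs]

theorem norm_trigSum_sq {n : ℕ} (x : Fin n → V) (α : Fin n → ℝ) (ξ : V) :
    ((‖trigSum x α ξ‖ ^ 2 : ℝ) : ℂ) =
      ∑ i, ∑ j, (α i * α j : ℂ) * ((𝐞 (inner ℝ ξ (x i - x j)) : Circle) : ℂ) := by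
  push_cast
  rw [← Complex.mul_conj', trigSum, map_sum, Finset.sum_mul_sum]
  refine Finset.sum_congr rfl fun i _ => Finset.sum_congr rfl fun j _ => ?_
  rw [map_mul, Complex.conj_ofReal, inner_sub_right, sub_eq_add_neg, AddChar.map_add_eq_mul,
    AddChar.map_neg_eq_inv, Circle.coe_mul, Circle.coe_inv_eq_conj]
  ring

theorem SchwartzMap.exists_norm_sq_le_besselWeight (f : 𝓢(V, ℂ)) (s : ℝ) :
    ∃ C, 0 < C ∧ ∀ ξ, ‖f ξ‖ ^ 2 ≤ C * besselWeight s ξ := by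
  obtain ⟨N, hN⟩ := exists_nat_ge s
  obtain ⟨K, hK⟩ : ∃ K, ∀ ξ, (1 + ‖ξ‖) ^ N * ‖f ξ‖ ≤ K := ⟨_, fun ξ => by
    simpa using SchwartzMap.one_add_le_sup_seminorm_apply (𝕜 := ℝ) (m := (N, 0)) le_rfl le_rfl f ξ⟩
  have hK0 : 0 ≤ K := le_trans (by positivity) (hK 0)
  -- The summand 1 only keeps the constant positive when `K = 0`.
  refine ⟨(2 * π) ^ (2 * N) * K ^ 2 + 1, by positivity, fun ξ => ?_⟩
  rw [besselWeight, rpow_neg (by positivity), ← div_eq_mul_inv, le_div_iff₀ (by positivity)]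
  have hπ : 1 ≤ 2 * π := by linarith [Real.pi_gt_three]
  have hbase : 1 + (2 * π * ‖ξ‖) ^ 2 ≤ (2 * π * (1 + ‖ξ‖)) ^ 2 := by
    have := norm_nonneg ξ
    have h1 : 1 ≤ (2 * π) ^ 2 := one_le_pow₀ hπ
    nlinarith [mul_nonneg (sq_nonneg (2 * π)) this]
  calc ‖f ξ‖ ^ 2 * (1 + (2 * π * ‖ξ‖) ^ 2) ^ s
      ≤ ‖f ξ‖ ^ 2 * (1 + (2 * π * ‖ξ‖) ^ 2) ^ (N : ℝ) := by
        gcongr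
        nlinarith [sq_nonneg (2 * π * ‖ξ‖)]
    _ ≤ ‖f ξ‖ ^ 2 * ((2 * π * (1 + ‖ξ‖)) ^ 2) ^ N := by
        rw [rpow_natCast]
        gcongr
    _ = (2 * π) ^ (2 * N) * ((1 + ‖ξ‖) ^ N * ‖f ξ‖) ^ 2 := by
        rw [← pow_mul, mul_pow (2 * π)]
        ring
    _ ≤ (2 * π) ^ (2 * N) * K ^ 2 := by
        gcongr
        exact hK ξ
    _ ≤ _ := by linarith

variable [FiniteDimensional ℝ V] [MeasurableSpace V] [BorelSpace V]

theorem MeasureTheory.Integrable.mul_norm_trigSum_sq {w : V → ℝ} (hw : Integrable w) {n : ℕ}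
    (x : Fin n → V) (α : Fin n → ℝ) : Integrable fun ξ => w ξ * ‖trigSum x α ξ‖ ^ 2 := by
  refine hw.mul_bdd (c := (∑ j, |α j|) ^ 2) ((continuous_trigSum x α).norm.pow 2).aestronglyMeasurable
    (Filter.Eventually.of_forall fun ξ => ?_)
  rw [norm_pow, norm_norm]
  gcongr
  exact norm_trigSum_le x α ξ

/-- The easy direction of Bochner's theorem. It serves both for the kernel weights and for the
localizers. -/
theorem integral_mul_norm_trigSum_sq {w : V → ℝ} (hw : Integrable w) {n : ℕ}
    (x : Fin n → V) (α : Fin n → ℝ) :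
    ((∫ ξ, w ξ * ‖trigSum x α ξ‖ ^ 2 : ℝ) : ℂ) =
      ∑ i, ∑ j, (α i * α j : ℂ) * 𝓕⁻ (fun ξ => (w ξ : ℂ)) (x i - x j) := by
  have hint : ∀ y : V, Integrable fun ξ => ((𝐞 (inner ℝ ξ y) : Circle) : ℂ) * (w ξ : ℂ) := fun y => by
    refine hw.ofReal.bdd_mul (c := 1) ?_ (Filter.Eventually.of_forall fun ξ => (Circle.norm_coe _).le)
    refine Continuous.aestronglyMeasurable ?_
    simp only [Real.fourierChar_apply]
    fun_prop
  rw [← integral_complex_ofReal]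
  simp only [Complex.ofReal_mul, norm_trigSum_sq, Real.fourierInv_eq, Circle.smul_def, smul_eq_mul,
    Finset.mul_sum]
  rw [integral_finsetSum]
  · refine Finset.sum_congr rfl fun i _ => ?_
    rw [integral_finsetSum]
    · refine Finset.sum_congr rfl fun j _ => ?_
      rw [← integral_const_mul]
      congr 1 with ξ
      ring
    · intro j _
      refine ((hint (x i - x j)).const_mul (α i * α j : ℂ)).congr
        (Filter.Eventually.of_forall fun ξ => ?_)
      ring
  · intro i _
    refine integrable_finsetSum _ fun j _ => ?_
    refine ((hint (x i - x j)).const_mul (α i * α j : ℂ)).congr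
      (Filter.Eventually.of_forall fun ξ => ?_)
    ring

theorem integrable_besselWeight {s : ℝ} (hs : (Module.finrank ℝ V : ℝ) / 2 < s) :
    Integrable (besselWeight s : V → ℝ) := by
  have h := (integrable_rpow_neg_one_add_norm_sq (E := V) (μ := volume) (r := 2 * s)
    (by linarith)).comp_smul (R := 2 * π) (by positivity)
  convert h using 2 with ξ
  rw [besselWeight, norm_smul, Real.norm_of_nonneg (by positivity)]
  congr 1
  ring

/-- There is a nonnegative rapidly decaying function, positive at the origin, whose inverse Fourier
transform is supported in the unit ball. -/
theorem exists_nonneg_fourierInv_eq_zero : ∃ h : V → ℝ, Continuous h ∧ (∀ ξ, 0 ≤ h ξ) ∧ 0 < h 0 ∧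
    Integrable h ∧ (∀ s, ∃ C, 0 < C ∧ ∀ ξ, h ξ ≤ C * besselWeight s ξ) ∧
    ∀ y, 1 ≤ ‖y‖ → 𝓕⁻ (fun ξ => (h ξ : ℂ)) y = 0 := by
  -- The function sought is |𝓕 b|², whose inverse transform is the autocorrelation of `b`. Outer
  -- radius 1/2 makes it vanish for ‖y‖ ≥ 1.
  let b : ContDiffBump (0 : V) := ⟨1 / 4, 1 / 2, by norm_num, by norm_num⟩
  have hsmooth : ContDiff ℝ (⊤ : ℕ∞) fun v => (b v : ℂ) := Complex.ofRealCLM.contDiff.comp b.contDiff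
  have hcpt : HasCompactSupport fun v => (b v : ℂ) := b.hasCompactSupport.comp_left Complex.ofReal_zero
  let ψ : 𝓢(V, ℂ) := hcpt.toSchwartzMap hsmooth
  have hψ : ∀ v, ψ v = (b v : ℂ) := fun v => rfl
  have hdecay : ∀ s, ∃ C, 0 < C ∧ ∀ ξ, ‖𝓕 ψ ξ‖ ^ 2 ≤ C * besselWeight s ξ :=
    (𝓕 ψ).exists_norm_sq_le_besselWeight
  have hcont : Continuous fun ξ => ‖𝓕 ψ ξ‖ ^ 2 := (𝓕 ψ).continuous.norm.pow 2
  refine ⟨fun ξ => ‖𝓕 ψ ξ‖ ^ 2, hcont, fun ξ => by positivity, ?_, ?_, hdecay, fun y hy => ?_⟩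
  · have h0 : 𝓕 ψ 0 = ((∫ v, b v : ℝ) : ℂ) := by
      rw [SchwartzMap.fourier_coe, Real.fourier_eq, ← integral_complex_ofReal]
      simp [hψ]
    have hpos : 0 < ∫ v, b v := b.integral_pos
    simp only [h0, Complex.norm_real]
    exact pow_pos (norm_pos_iff.mpr hpos.ne') 2
  · obtain ⟨C, hC, hCb⟩ := hdecay (Module.finrank ℝ V + 1)
    refine ((integrable_besselWeight (V := V) (s := Module.finrank ℝ V + 1) (by
      have : (0 : ℝ) ≤ Module.finrank ℝ V := by positivity
      linarith)).const_mul C).mono' hcont.aestronglyMeasurable (Filter.Eventually.of_forall fun ξ => ?_)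
    rw [Real.norm_of_nonneg (by positivity)]
    exact hCb ξ
  · have hsmooth' : ContDiff ℝ (⊤ : ℕ∞) fun v => (b (v + y) : ℂ) :=
      hsmooth.comp (contDiff_id.add contDiff_const)
    have hcpt' : HasCompactSupport fun v => (b (v + y) : ℂ) :=
      hcpt.comp_homeomorph (Homeomorph.addRight y)
    let φ : 𝓢(V, ℂ) := hcpt'.toSchwartzMap hsmooth'
    have hφ : ∀ v, φ v = (b (v + y) : ℂ) := fun v => rfl
    have hF : ∀ ξ, 𝓕 φ ξ = ((𝐞 (inner ℝ ξ y) : Circle) : ℂ) * 𝓕 ψ ξ := fun ξ => by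
      rw [SchwartzMap.fourier_coe, SchwartzMap.fourier_coe, Real.fourier_eq, Real.fourier_eq,
        ← integral_add_right_eq_self _ (-y), ← integral_const_mul]
      congr 1 with v
      rw [hφ, hψ, neg_add_cancel_right, Circle.smul_def, Circle.smul_def, inner_add_left,
        inner_neg_left, neg_add, neg_neg, AddChar.map_add_eq_mul, Circle.coe_mul,
        real_inner_comm ξ y]
      simp only [smul_eq_mul]
      ring
    -- Parseval for the bump and its translate by `y`: their supports are disjoint, and translation
    -- appears in frequency as the character needed for 𝓕⁻.
    have hP := SchwartzMap.integral_inner_fourier_fourier ψ φ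
    have hz : ∀ v, inner ℂ (ψ v) (φ v) = 0 := fun v => by
      rw [hψ, hφ]
      by_cases hv : v ∈ Metric.ball (0 : V) (1 / 2)
      · have : v + y ∉ Metric.ball (0 : V) (1 / 2) := fun hvy => by
          rw [mem_ball_zero_iff] at hv hvy
          have := norm_sub_le (v + y) v
          rw [add_sub_cancel_left] at this
          linarith
        have : b (v + y) = 0 := by
          rw [← Function.notMem_support, b.support_eq]; exact this
        simp [this]
      · have : b v = 0 := by
          rw [← Function.notMem_support, b.support_eq]; exact hv
        simp [this]
    simp only [hz, integral_zero, hF] at hP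
    rw [Real.fourierInv_eq, ← hP]
    congr 1 with ξ
    rw [Circle.smul_def, smul_eq_mul, RCLike.inner_apply, mul_assoc, Complex.mul_conj']
    push_cast
    rfl

theorem fourierInv_comp_smul_sub (h : V → ℂ) {q : ℝ} (hq : 0 < q) (η y : V) :
    𝓕⁻ (fun ξ => h (q • ξ - η)) y =
      ((q ^ Module.finrank ℝ V)⁻¹ : ℝ) * ((𝐞 (inner ℝ η (q⁻¹ • y)) : Circle) : ℂ) * 𝓕⁻ h (q⁻¹ • y) := by
  rw [Real.fourierInv_eq, Real.fourierInv_eq]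
  let F : V → ℂ := fun ζ => ((𝐞 (inner ℝ (ζ + η) (q⁻¹ • y)) : Circle) : ℂ) * h ζ
  have h1 : ∀ ξ : V, 𝐞 (inner ℝ ξ y) • h (q • ξ - η) = (fun ζ => F (ζ - η)) (q • ξ) := fun ξ => by
    simp only [F, Circle.smul_def, smul_eq_mul, sub_add_cancel, inner_smul_left, inner_smul_right]
    congr 4
    simp [hq.ne']
  simp_rw [h1]
  rw [Measure.integral_comp_smul volume (fun ζ => F (ζ - η)), integral_sub_right_eq_self, abs_of_pos (by positivity),
    mul_assoc, ← integral_const_mul, Complex.real_smul]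
  congr 2 with ζ
  simp only [F, Circle.smul_def, smul_eq_mul, inner_add_left, AddChar.map_add_eq_mul,
    Circle.coe_mul]
  ring

/-- Dilation by `q` rescales the differences of nodes to norm at least 1, where 𝓕⁻ h vanishes, so
only the diagonal survives. The shift `η` contributes just a phase, which is 1 on the diagonal. -/
theorem integral_smul_sub_mul_norm_trigSum_sq {h : V → ℝ} (hint : Integrable h)
    (hh : ∀ y, 1 ≤ ‖y‖ → 𝓕⁻ (fun ξ => (h ξ : ℂ)) y = 0) {q : ℝ} (hq : 0 < q) {n : ℕ}
    {x : Fin n → V} (hx : ∀ i j, i ≠ j → q ≤ ‖x i - x j‖) (α : Fin n → ℝ) (η : V) :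
    ∫ ξ, h (q • ξ - η) * ‖trigSum x α ξ‖ ^ 2 =
      (q ^ Module.finrank ℝ V)⁻¹ * (∫ ξ, h ξ) * ∑ i, α i ^ 2 := by
  have hint' : Integrable fun ξ => h (q • ξ - η) :=
    (hint.comp_sub_right η).comp_smul hq.ne'
  apply Complex.ofReal_injective
  rw [integral_mul_norm_trigSum_sq hint']
  have hoff : ∀ i j, i ≠ j → 𝓕⁻ (fun ξ => (h (q • ξ - η) : ℂ)) (x i - x j) = 0 := fun i j hij => by
    rw [fourierInv_comp_smul_sub (fun ξ => (h ξ : ℂ)) hq, hh, mul_zero]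
    rw [norm_smul, norm_inv, Real.norm_of_nonneg hq.le, ← div_eq_inv_mul, one_le_div hq]
    exact hx i j hij
  have hdiag : 𝓕⁻ (fun ξ => (h (q • ξ - η) : ℂ)) 0 =
      (((q ^ Module.finrank ℝ V)⁻¹ * ∫ ξ, h ξ : ℝ) : ℂ) := by
    rw [fourierInv_comp_smul_sub (fun ξ => (h ξ : ℂ)) hq, Real.fourierInv_eq]
    simp [integral_complex_ofReal]
  rw [Complex.ofReal_mul, Complex.ofReal_sum, Finset.mul_sum]
  refine Finset.sum_congr rfl fun i _ => ?_
  rw [Finset.sum_eq_single i (fun j _ hj => by rw [hoff i j hj.symm, mul_zero]) (by simp),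
    sub_self, hdiag]
  push_cast
  ring

-- Convolving the weight with `h` loses at most a constant: near the origin `h` exceeds `h 0 / 2`,
-- and on such a ball the weight is nearly constant. The lower Lebesgue integral makes Tonelli
-- directly applicable later.
open scoped ENNReal in
theorem exists_ofReal_besselWeight_le_lintegral {h : V → ℝ} (hc : Continuous h)
    (h0 : 0 < h 0) {s : ℝ} (hs : 0 ≤ s) : ∃ C : ℝ≥0∞, C ≠ ∞ ∧ ∀ ζ : V,
      ENNReal.ofReal (besselWeight s ζ) ≤
        C * ∫⁻ η, ENNReal.ofReal (besselWeight s η) * ENNReal.ofReal (h (ζ - η)) := by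
  obtain ⟨r, hr, hball⟩ := Metric.eventually_nhds_iff.mp
    (hc.continuousAt.eventually_const_lt (half_lt_self h0))
  set K : ℝ := (2 + 2 * (2 * π * r) ^ 2) ^ s with hK
  have hKpos : 0 < K := by positivity
  have hvol : volume (Metric.ball (0 : V) r) ≠ 0 := (Metric.measure_ball_pos _ _ hr).ne'
  have hvol' : volume (Metric.ball (0 : V) r) ≠ ∞ := measure_ball_lt_top.ne
  have hKh : ENNReal.ofReal (K⁻¹ * (h 0 / 2)) ≠ 0 := by
    rw [ne_eq, ENNReal.ofReal_eq_zero, not_le]; positivity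
  refine ⟨(ENNReal.ofReal (K⁻¹ * (h 0 / 2)) * volume (Metric.ball (0 : V) r))⁻¹,
    ENNReal.inv_ne_top.mpr (mul_ne_zero hKh hvol), fun ζ => ?_⟩
  rw [mul_comm, ← div_eq_mul_inv, ENNReal.le_div_iff_mul_le (Or.inl (mul_ne_zero hKh hvol))
    (Or.inl (ENNReal.mul_ne_top ENNReal.ofReal_ne_top hvol'))]
  calc ENNReal.ofReal (besselWeight s ζ) *
        (ENNReal.ofReal (K⁻¹ * (h 0 / 2)) * volume (Metric.ball (0 : V) r))
      = ∫⁻ _ in Metric.ball ζ r, ENNReal.ofReal (besselWeight s ζ * (K⁻¹ * (h 0 / 2))) := by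
        rw [setLIntegral_const, ENNReal.ofReal_mul (besselWeight_pos s ζ).le, ← mul_assoc,
          Measure.addHaar_ball_center volume ζ]
    _ ≤ ∫⁻ η in Metric.ball ζ r, ENNReal.ofReal (besselWeight s η) * ENNReal.ofReal (h (ζ - η)) := by
        refine setLIntegral_mono' measurableSet_ball fun η hη => ?_
        rw [← ENNReal.ofReal_mul (besselWeight_pos s η).le, ← mul_assoc]
        apply ENNReal.ofReal_le_ofReal
        have h1 : h 0 / 2 < h (ζ - η) := hball (by
          rw [dist_zero_right, ← dist_eq_norm, dist_comm]; exact hη)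
        have h2 := besselWeight_le_mul_of_dist_lt hs (Metric.mem_ball.mp hη)
        rw [← hK] at h2
        have h3 : besselWeight s ζ * K⁻¹ ≤ besselWeight s η := by
          rw [← div_eq_mul_inv, div_le_iff₀ hKpos]
          linarith
        exact mul_le_mul h3 h1.le (by positivity) (besselWeight_pos s η).le
    _ ≤ _ := setLIntegral_le_lintegral _ _

end Frequency

/-! ### Comparison of weighted integrals for separated nodes -/

section Comparison

open scoped FourierTransform ENNReal

theorem one_add_sq_le_inv_sq_mul {q D a : ℝ} (hq : 0 < q) (hqD : q ≤ D) :
    1 + a ^ 2 ≤ (D ^ 2 + 1) * (q ^ 2)⁻¹ * (1 + (q * a) ^ 2) := by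
  have h1 : q ^ 2 ≤ D ^ 2 := by gcongr
  rw [mul_assoc, mul_comm, mul_assoc, ← div_eq_inv_mul, le_div_iff₀ (by positivity)]
  nlinarith [sq_nonneg (q * a), sq_nonneg (D * (q * a))]

variable {V : Type*} [NormedAddCommGroup V] [InnerProductSpace ℝ V]

/-- The first term dominates at low frequencies, 2πq‖ξ‖ ≤ 1, and the second at high ones, where 1 +
(qa)² ≤ 2(qa)² with a = 2π‖ξ‖. -/
theorem besselWeight_le_add {D s t q : ℝ} (hs : 0 ≤ s) (hst : s ≤ t) (hq : 0 < q) (hqD : q ≤ D)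
    (ξ : V) : besselWeight s ξ ≤ (D ^ 2 + 1) ^ (t - s) * q ^ (-(2 * (t - s))) * besselWeight t ξ +
      2 ^ s * q ^ (2 * s) * besselWeight s (q • ξ) := by
  have hsq : ∀ r : ℝ, (q ^ 2) ^ r = q ^ (2 * r) := fun r => by
    rw [rpow_mul hq.le]; norm_cast
  set a := 2 * π * ‖ξ‖ with ha
  have ha0 : 0 ≤ a := by positivity
  have h5 : besselWeight s (q • ξ) = ((1 + (q * a) ^ 2) ^ s)⁻¹ := by
    rw [besselWeight, rpow_neg (by positivity), norm_smul, Real.norm_of_nonneg hq.le,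
      mul_left_comm]
  have hw1 := besselWeight_pos t ξ
  have hw2 := besselWeight_pos s (q • ξ)
  rcases le_total (q * a) 1 with hqa | hqa
  · refine le_trans ?_ (le_add_of_nonneg_right (by positivity))
    have h1 : 1 + a ^ 2 ≤ (D ^ 2 + 1) * (q ^ 2)⁻¹ := by
      rw [← div_eq_mul_inv, le_div_iff₀ (by positivity)]
      have h2 : q ^ 2 ≤ D ^ 2 := by gcongr
      have h3 : (q * a) ^ 2 ≤ 1 := pow_le_one₀ (by positivity) hqa
      nlinarith
    have h2 := rpow_le_rpow (by positivity) h1 (sub_nonneg.mpr hst)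
    rw [mul_rpow (by positivity) (by positivity), inv_rpow (by positivity), hsq,
      ← rpow_neg hq.le] at h2
    have h3 : besselWeight s ξ = (1 + a ^ 2) ^ (t - s) * besselWeight t ξ := by
      rw [besselWeight, besselWeight, ← ha, ← rpow_add (by positivity)]
      congr 1
      ring
    rw [h3]
    gcongr
  · refine le_trans ?_ (le_add_of_nonneg_left (by positivity))
    have h1 : 1 + (q * a) ^ 2 ≤ 2 * q ^ 2 * (1 + a ^ 2) := by
      have : 1 ≤ (q * a) ^ 2 := one_le_pow₀ hqa
      nlinarith [sq_nonneg q]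
    have h2 := rpow_le_rpow (by positivity) h1 hs
    rw [mul_rpow (by positivity) (by positivity), mul_rpow (by positivity) (by positivity),
      hsq] at h2
    rw [h5, besselWeight, ← ha, rpow_neg (by positivity), ← div_eq_mul_inv,
      le_div_iff₀ (by positivity), inv_mul_le_iff₀ (by positivity)]
    linarith

variable [FiniteDimensional ℝ V] [MeasurableSpace V] [BorelSpace V]

/-- The dilated weight is dominated by a superposition of translates of `h` with integrable density
`besselWeight s`. After Tonelli each translate contributes the same diagonal value. -/
theorem exists_integral_besselWeight_smul_le {s : ℝ} (hs : (Module.finrank ℝ V : ℝ) / 2 < s) :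
    ∃ C, 0 ≤ C ∧ ∀ q : ℝ, 0 < q → ∀ (n : ℕ) (x : Fin n → V), (∀ i j, i ≠ j → q ≤ ‖x i - x j‖) →
      ∀ α : Fin n → ℝ, ∫ ξ, besselWeight s (q • ξ) * ‖trigSum x α ξ‖ ^ 2 ≤
        C * ((q ^ Module.finrank ℝ V)⁻¹ * ∑ i, α i ^ 2) := by
  obtain ⟨h, hc, hnn, h0, hint, -, hsupp⟩ := exists_nonneg_fourierInv_eq_zero (V := V)
  have hs0 : 0 ≤ s := le_trans (by positivity) hs.le
  obtain ⟨K, hK, hKle⟩ := exists_ofReal_besselWeight_le_lintegral hc h0 hs0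
  have hw := integrable_besselWeight hs
  refine ⟨K.toReal * (∫ η : V, besselWeight s η) * ∫ ξ, h ξ, ?_, fun q hq n x hx α => ?_⟩
  · have h1 : 0 ≤ ∫ η : V, besselWeight s η := integral_nonneg fun η => (besselWeight_pos s η).le
    have h2 : 0 ≤ ∫ ξ, h ξ := integral_nonneg hnn
    positivity
  set J : ℝ := (q ^ Module.finrank ℝ V)⁻¹ * (∫ ξ, h ξ) * ∑ i, α i ^ 2 with hJ
  have hwq : Integrable fun ξ : V => besselWeight s (q • ξ) := hw.comp_smul hq.ne'
  have hinner : ∀ η : V, ∫⁻ ξ, ENNReal.ofReal (h (q • ξ - η)) * ENNReal.ofReal (‖trigSum x α ξ‖ ^ 2)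
      = ENNReal.ofReal J := fun η => by
    have hi : Integrable fun ξ => h (q • ξ - η) := (hint.comp_sub_right η).comp_smul hq.ne'
    rw [hJ, ← integral_smul_sub_mul_norm_trigSum_sq hint hsupp hq hx α η,
      ofReal_integral_eq_lintegral_ofReal (hi.mul_norm_trigSum_sq x α)
        (Filter.Eventually.of_forall fun ξ => mul_nonneg (hnn _) (by positivity))]
    congr 1 with ξ
    rw [ENNReal.ofReal_mul (hnn _)]
  have hmain : ENNReal.ofReal (∫ ξ, besselWeight s (q • ξ) * ‖trigSum x α ξ‖ ^ 2) ≤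
      K * (ENNReal.ofReal (∫ η : V, besselWeight s η) * ENNReal.ofReal J) := by
    rw [ofReal_integral_eq_lintegral_ofReal (hwq.mul_norm_trigSum_sq x α)
      (Filter.Eventually.of_forall fun ξ => mul_nonneg (besselWeight_pos _ _).le (by positivity))]
    have hm1 : Measurable fun p : V × V => ENNReal.ofReal (besselWeight s p.2) *
        ENNReal.ofReal (h (q • p.1 - p.2)) * ENNReal.ofReal (‖trigSum x α p.1‖ ^ 2) := by
      have := (continuous_besselWeight (V := V) s).measurable
      have := hc.measurable
      have := (continuous_trigSum x α).measurable
      fun_prop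
    have hm2 : ∀ ξ, Measurable fun η : V => ENNReal.ofReal (besselWeight s η) *
        ENNReal.ofReal (h (q • ξ - η)) := fun ξ => by
      have := (continuous_besselWeight (V := V) s).measurable
      have := hc.measurable
      fun_prop
    have hm3 : ∀ η, Measurable fun ξ : V => ENNReal.ofReal (h (q • ξ - η)) *
        ENNReal.ofReal (‖trigSum x α ξ‖ ^ 2) := fun ξ => by
      have := hc.measurable
      have := (continuous_trigSum x α).measurable
      fun_prop
    calc ∫⁻ ξ, ENNReal.ofReal (besselWeight s (q • ξ) * ‖trigSum x α ξ‖ ^ 2)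
        ≤ ∫⁻ ξ, K * ∫⁻ η, ENNReal.ofReal (besselWeight s η) * ENNReal.ofReal (h (q • ξ - η)) *
            ENNReal.ofReal (‖trigSum x α ξ‖ ^ 2) := by
          refine lintegral_mono fun ξ => ?_
          rw [ENNReal.ofReal_mul (besselWeight_pos _ _).le, lintegral_mul_const _ (hm2 ξ),
            ← mul_assoc]
          gcongr
          exact hKle _
      _ = K * ∫⁻ η, ∫⁻ ξ, ENNReal.ofReal (besselWeight s η) * ENNReal.ofReal (h (q • ξ - η)) *
            ENNReal.ofReal (‖trigSum x α ξ‖ ^ 2) := by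
          rw [lintegral_const_mul' _ _ hK, lintegral_lintegral_swap hm1.aemeasurable]
      _ = K * ∫⁻ η : V, ENNReal.ofReal (besselWeight s η) * ENNReal.ofReal J := by
          congr 2 with η
          simp_rw [mul_assoc]
          rw [lintegral_const_mul _ (hm3 η), hinner]
      _ = _ := by
          rw [lintegral_mul_const _ (continuous_besselWeight s).measurable.ennreal_ofReal,
            ofReal_integral_eq_lintegral_ofReal hw
              (Filter.Eventually.of_forall fun η => (besselWeight_pos s η).le)]
  have hJ0 : 0 ≤ J := by
    have : 0 ≤ ∫ ξ, h ξ := integral_nonneg hnn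
    positivity
  have hI0 : 0 ≤ ∫ η : V, besselWeight s η := integral_nonneg fun η => (besselWeight_pos s η).le
  rw [← ENNReal.ofReal_toReal hK, ← ENNReal.ofReal_mul hI0, ← ENNReal.ofReal_mul (by positivity),
    ENNReal.ofReal_le_ofReal_iff (by positivity)] at hmain
  calc _ ≤ _ := hmain
    _ = _ := by rw [hJ]; ring

/-- A multiple of q^(2s) h(qξ) is a minorant of the weight, by the rapid decay of `h`, and its
integral is known exactly. The bound also yields positive definiteness of the kernel matrix. -/
theorem exists_integral_besselWeight_ge {D s : ℝ} (hs : (Module.finrank ℝ V : ℝ) / 2 < s) :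
    ∃ c, 0 < c ∧ ∀ q : ℝ, 0 < q → q ≤ D → ∀ (n : ℕ) (x : Fin n → V),
      (∀ i j, i ≠ j → q ≤ ‖x i - x j‖) →
      ∀ α : Fin n → ℝ, c * q ^ (2 * s) * ((q ^ Module.finrank ℝ V)⁻¹ * ∑ i, α i ^ 2) ≤
        ∫ ξ, besselWeight s ξ * ‖trigSum x α ξ‖ ^ 2 := by
  obtain ⟨h, hc, hnn, h0, hint, hdecay, hsupp⟩ := exists_nonneg_fourierInv_eq_zero (V := V)
  have hs0 : 0 ≤ s := le_trans (by positivity) hs.le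
  obtain ⟨K, hK, hKle⟩ := hdecay s
  have hI : 0 < ∫ ξ, h ξ := integral_pos_of_integrable_nonneg_nonzero hc hint hnn h0.ne'
  refine ⟨((D ^ 2 + 1) ^ s)⁻¹ * K⁻¹ * ∫ ξ, h ξ, by positivity, fun q hq hqD n x hx α => ?_⟩
  have hpt : ∀ ξ : V, ((D ^ 2 + 1) ^ s)⁻¹ * K⁻¹ * q ^ (2 * s) * h (q • ξ - 0) ≤
      besselWeight s ξ := fun ξ => by
    have h1 := rpow_le_rpow (by positivity)
      (one_add_sq_le_inv_sq_mul (a := 2 * π * ‖ξ‖) hq hqD) hs0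
    have h2 : 0 < q ^ (2 * s) := by positivity
    have h3 : (q ^ 2) ^ s = q ^ (2 * s) := by
      rw [rpow_mul hq.le]; norm_cast
    rw [mul_rpow (by positivity) (by positivity), mul_rpow (by positivity) (by positivity),
      inv_rpow (by positivity), h3] at h1
    have h4 := hKle (q • ξ)
    rw [sub_zero]
    have h5 : besselWeight s (q • ξ) = ((1 + (q * (2 * π * ‖ξ‖)) ^ 2) ^ s)⁻¹ := by
      rw [besselWeight, rpow_neg (by positivity), norm_smul, Real.norm_of_nonneg hq.le,
        mul_left_comm]
    calc ((D ^ 2 + 1) ^ s)⁻¹ * K⁻¹ * q ^ (2 * s) * h (q • ξ)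
        ≤ ((D ^ 2 + 1) ^ s)⁻¹ * K⁻¹ * q ^ (2 * s) * (K * besselWeight s (q • ξ)) := by gcongr
      _ = ((D ^ 2 + 1) ^ s * (q ^ (2 * s))⁻¹ * (1 + (q * (2 * π * ‖ξ‖)) ^ 2) ^ s)⁻¹ := by
          rw [h5]
          field_simp
      _ ≤ ((1 + (2 * π * ‖ξ‖) ^ 2) ^ s)⁻¹ := by gcongr
      _ = besselWeight s ξ := by rw [besselWeight, rpow_neg (by positivity)]
  have hi : Integrable fun ξ => h (q • ξ - 0) := (hint.comp_sub_right 0).comp_smul hq.ne'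
  calc _ = ∫ ξ, ((D ^ 2 + 1) ^ s)⁻¹ * K⁻¹ * q ^ (2 * s) * (h (q • ξ - 0) * ‖trigSum x α ξ‖ ^ 2) := by
        rw [integral_const_mul, integral_smul_sub_mul_norm_trigSum_sq hint hsupp hq hx α 0]
        ring
    _ ≤ _ := by
        refine integral_mono ((hi.mul_norm_trigSum_sq x α).const_mul _)
          ((integrable_besselWeight hs).mul_norm_trigSum_sq x α) fun ξ => ?_
        simp only [← mul_assoc]
        exact mul_le_mul_of_nonneg_right (hpt ξ) (by positivity)

/-- For separated nodes, the quadratic form with the weaker frequency weight is controlled by the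
one with the stronger weight, with the power of the separation distance given by scaling. -/
theorem exists_integral_besselWeight_le {D s t : ℝ} (hs : (Module.finrank ℝ V : ℝ) / 2 < s)
    (hst : s ≤ t) : ∃ c, 0 < c ∧ ∀ q : ℝ, 0 < q → q ≤ D → ∀ (n : ℕ) (x : Fin n → V),
      (∀ i j, i ≠ j → q ≤ ‖x i - x j‖) → ∀ α : Fin n → ℝ,
        ∫ ξ, besselWeight s ξ * ‖trigSum x α ξ‖ ^ 2 ≤
          c * q ^ (-(2 * (t - s))) * ∫ ξ, besselWeight t ξ * ‖trigSum x α ξ‖ ^ 2 := by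
  have hs0 : 0 ≤ s := le_trans (by positivity) hs.le
  obtain ⟨C, hC, hup⟩ := exists_integral_besselWeight_smul_le hs
  obtain ⟨c, hc, hlow⟩ := exists_integral_besselWeight_ge (D := D) (hs.trans_le hst)
  -- The first summand comes from low frequencies; the second bounds the high ones by |α|² and
  -- returns to the `t`-integral through the lower bound.
  refine ⟨(D ^ 2 + 1) ^ (t - s) + 2 ^ s * C * c⁻¹, by positivity, fun q hq hqD n x hx α => ?_⟩
  specialize hup q hq n x hx α
  specialize hlow q hq hqD n x hx α
  have hwt := (integrable_besselWeight (hs.trans_le hst)).mul_norm_trigSum_sq x α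
  have hws := (integrable_besselWeight hs).mul_norm_trigSum_sq x α
  have hwq := ((integrable_besselWeight hs).comp_smul hq.ne').mul_norm_trigSum_sq x α
  set I := ∫ ξ, besselWeight t ξ * ‖trigSum x α ξ‖ ^ 2
  set N := (q ^ Module.finrank ℝ V)⁻¹ * ∑ i, α i ^ 2
  have hsplit : q ^ (2 * s) = q ^ (-(2 * (t - s))) * q ^ (2 * t) := by
    rw [← rpow_add hq]; congr 1; ring
  have hN : q ^ (2 * t) * N ≤ c⁻¹ * I := by
    rw [← div_eq_inv_mul, le_div_iff₀ hc]; linarith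
  calc ∫ ξ, besselWeight s ξ * ‖trigSum x α ξ‖ ^ 2
      ≤ ∫ ξ, ((D ^ 2 + 1) ^ (t - s) * q ^ (-(2 * (t - s))) *
            (besselWeight t ξ * ‖trigSum x α ξ‖ ^ 2) +
          2 ^ s * q ^ (2 * s) * (besselWeight s (q • ξ) * ‖trigSum x α ξ‖ ^ 2)) := by
        refine integral_mono hws ((hwt.const_mul _).add (hwq.const_mul _)) fun ξ => ?_
        have := mul_le_mul_of_nonneg_right (besselWeight_le_add hs0 hst hq hqD ξ)
          (sq_nonneg ‖trigSum x α ξ‖)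
        refine this.trans (le_of_eq ?_)
        ring
    _ = (D ^ 2 + 1) ^ (t - s) * q ^ (-(2 * (t - s))) * I + 2 ^ s * q ^ (2 * s) *
          ∫ ξ, besselWeight s (q • ξ) * ‖trigSum x α ξ‖ ^ 2 := by
        rw [integral_add (hwt.const_mul _) (hwq.const_mul _), integral_const_mul,
          integral_const_mul]
    _ ≤ (D ^ 2 + 1) ^ (t - s) * q ^ (-(2 * (t - s))) * I + 2 ^ s * q ^ (2 * s) * (C * N) := by
        gcongr
    _ = (D ^ 2 + 1) ^ (t - s) * q ^ (-(2 * (t - s))) * I +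
          2 ^ s * q ^ (-(2 * (t - s))) * C * (q ^ (2 * t) * N) := by
        rw [hsplit]; ring
    _ ≤ (D ^ 2 + 1) ^ (t - s) * q ^ (-(2 * (t - s))) * I +
          2 ^ s * q ^ (-(2 * (t - s))) * C * (c⁻¹ * I) := by gcongr
    _ = _ := by ring

end Comparison

/-! ### Kernel matrices as weighted frequency integrals -/

section Sobolev

open scoped FourierTransform

variable {d : ℕ}

/-- Substituting ω = 2πξ passes between the two Fourier normalizations. Inversion holds at every
point because Φ is continuous and `s > d/2` makes its transform integrable. -/
theorem IsSobolevFunction.ofReal_eq_fourierInv {Φ : EuclideanSpace ℝ (Fin d) → ℝ} {s : ℝ}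
    (hΦ : IsSobolevFunction Φ s) (hs : (d : ℝ) / 2 < s) (x : EuclideanSpace ℝ (Fin d)) :
    (Φ x : ℂ) = (((2 * π) ^ ((d : ℝ) / 2) : ℝ) : ℂ) *
      𝓕⁻ (fun ξ : EuclideanSpace ℝ (Fin d) => (besselWeight s ξ : ℂ)) x := by
  have hF : 𝓕 (fun x => (Φ x : ℂ)) = fun ξ : EuclideanSpace ℝ (Fin d) =>
      (((2 * π) ^ ((d : ℝ) / 2) : ℝ) : ℂ) * (besselWeight s ξ : ℂ) := by
    ext ξ
    have h := hΦ.fourierHat_eq ((2 * π) • ξ)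
    rw [fourierHat, norm_smul, Real.norm_of_nonneg (by positivity : 0 ≤ 2 * π)] at h
    rw [besselWeight, ← h, ← mul_assoc, ← Complex.ofReal_mul, ← rpow_add (by positivity),
      neg_div, add_neg_cancel, rpow_zero, Complex.ofReal_one, one_mul, Real.fourier_eq]
    congr 1 with v
    rw [Circle.smul_def, Real.fourierChar_apply, smul_eq_mul, mul_comm, real_inner_smul_left,
      real_inner_comm]
    congr 2
    push_cast
    ring
  have hw := integrable_besselWeight (V := EuclideanSpace ℝ (Fin d)) (s := s)
    (by rwa [finrank_euclideanSpace_fin])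
  have hcont : Continuous fun x => (Φ x : ℂ) := Complex.continuous_ofReal.comp hΦ.continuous
  have hinv := hcont.fourierInv_fourier_eq hΦ.integrable.ofReal
    (by rw [hF]; exact hw.ofReal.const_mul _)
  have := congrFun hinv x
  rw [← this, hF, Real.fourierInv_eq, Real.fourierInv_eq, ← integral_const_mul]
  congr 1 with ξ
  rw [Circle.smul_def, Circle.smul_def, smul_eq_mul, smul_eq_mul, mul_left_comm]

theorem PDKernel.IsTranslationInvariant.quadForm_eq {Ω : Set (EuclideanSpace ℝ (Fin d))}
    {k : PDKernel Ω} {Φ : EuclideanSpace ℝ (Fin d) → ℝ} {s : ℝ} (hk : k.IsTranslationInvariant Φ)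
    (hΦ : IsSobolevFunction Φ s) (hs : (d : ℝ) / 2 < s) {n : ℕ} (x : Fin n → Ω) (α : Fin n → ℝ) :
    α ⬝ᵥ (k.matrix x *ᵥ α) = (2 * π) ^ ((d : ℝ) / 2) *
      ∫ ξ, besselWeight s ξ *
        ‖trigSum (fun i => (x i : EuclideanSpace ℝ (Fin d))) α ξ‖ ^ 2 := by
  apply Complex.ofReal_injective
  rw [Complex.ofReal_mul, integral_mul_norm_trigSum_sq (integrable_besselWeight
    (by rwa [finrank_euclideanSpace_fin])), Finset.mul_sum]
  simp only [dotProduct, mulVec, PDKernel.matrix, submatrix_apply, hk _ _, Finset.mul_sum]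
  push_cast
  refine Finset.sum_congr rfl fun i _ => Finset.sum_congr rfl fun j _ => ?_
  rw [hΦ.ofReal_eq_fourierInv hs]
  ring

end Sobolev

/-! ### Separation distance and the main theorem -/

theorem sepDist_pos {d n : ℕ} (hn : 2 ≤ n) {x : Fin n → EuclideanSpace ℝ (Fin d)}
    (hx : Function.Injective x) : 0 < sepDist x := by
  have : Nontrivial (Fin n) := Fin.nontrivial_iff_two_le.mpr hn
  refine (Set.Finite.infsep_pos_iff_nontrivial (Set.finite_range x)).mpr ?_
  rw [← Set.image_univ]
  exact Set.nontrivial_univ.image hx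

theorem sepDist_le_norm_sub {d n : ℕ} {x : Fin n → EuclideanSpace ℝ (Fin d)}
    (hx : Function.Injective x) {i j : Fin n} (hij : i ≠ j) : sepDist x ≤ ‖x i - x j‖ := by
  rw [← dist_eq_norm]
  have : Finite (Set.range x) := Set.finite_range x
  exact Set.infsep_le_dist_of_mem (Set.mem_range_self i) (Set.mem_range_self j) (hx.ne hij)

theorem mainTheorem4 (d : ℕ) (Ω : Set (EuclideanSpace ℝ (Fin d))) (hΩ : Bornology.IsBounded Ω)
    (τ σ : ℝ) (hτ : (d : ℝ) / 2 < τ) (hσ : (d : ℝ) / (2 * τ) < σ) (hσ1 : σ ≤ 1) :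
    ∃ c' : ℝ, 0 < c' ∧
      ∀ (Φ Φσ : EuclideanSpace ℝ (Fin d) → ℝ),
        IsSobolevFunction Φ τ → IsSobolevFunction Φσ (σ * τ) →
      ∀ (k kσ k' kσ' : PDKernel Ω),
        k.IsTranslationInvariant Φ → kσ.IsTranslationInvariant Φσ →
      ∀ (C C₁ : ℝ), 0 < C → 0 < C₁ →
        k.NormEquivalent k' C → kσ.NormEquivalent kσ' C₁ →
      ∀ (n : ℕ) (x : Fin n → Ω), 2 ≤ n → Function.Injective x →
        (∀ α : Fin n → ℝ, α ≠ 0 → 0 < α ⬝ᵥ (k'.matrix x *ᵥ α)) ∧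
        (∃ m M : ℝ,
          IsLeast (rayleighQuotients (kσ'.matrix x) (k'.matrix x)) m ∧
          IsGreatest (rayleighQuotients (kσ'.matrix x) (k'.matrix x)) M ∧
          C₁ ^ (-2 : ℤ) * C ^ (-2 : ℤ) ≤ m ∧ m ≤ M ∧
          M ≤ C₁ ^ 2 * C ^ 2 * c' *
            sepDist (fun i => (x i : EuclideanSpace ℝ (Fin d))) ^ (-(1 - σ) * (2 * τ))) ∧
        (∀ i : Fin n,
          C₁ ^ (-2 : ℤ) * C ^ (-2 : ℤ) * k'.eigenvalue x i ≤ kσ'.eigenvalue x i ∧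
          kσ'.eigenvalue x i ≤ C₁ ^ 2 * C ^ 2 * c' *
            sepDist (fun i => (x i : EuclideanSpace ℝ (Fin d))) ^ (-(1 - σ) * (2 * τ)) *
              k'.eigenvalue x i) := by
  have hτ0 : 0 < τ := lt_of_le_of_lt (by positivity) hτ
  have hστ : (d : ℝ) / 2 < σ * τ := by
    rw [div_lt_iff₀ (by positivity)] at hσ
    linarith
  have hle : σ * τ ≤ τ := mul_le_of_le_one_left hτ0.le hσ1
  obtain ⟨D, hD⟩ := Metric.isBounded_iff.mp hΩ
  -- The constant is fixed before any kernel or node; Ω enters only through the diameter bound `D`.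
  obtain ⟨c', hc', hupper⟩ := exists_integral_besselWeight_le
    (V := EuclideanSpace ℝ (Fin d)) (D := D) (s := σ * τ) (t := τ)
    (by rwa [finrank_euclideanSpace_fin]) hle
  obtain ⟨c, hc, hlower⟩ := exists_integral_besselWeight_ge
    (V := EuclideanSpace ℝ (Fin d)) (D := D) (s := τ) (by rwa [finrank_euclideanSpace_fin])
  refine ⟨c', hc', fun Φ Φσ hΦ hΦσ k kσ k' kσ' hk hkσ C C₁ hC hC₁ hkk hkkσ n x hn hx => ?_⟩
  set y : Fin n → EuclideanSpace ℝ (Fin d) := fun i => (x i : EuclideanSpace ℝ (Fin d)) with hy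
  have hyinj : Function.Injective y := Subtype.val_injective.comp hx
  set q := sepDist y
  have hq : 0 < q := sepDist_pos hn hyinj
  have hsep : ∀ i j, i ≠ j → q ≤ ‖y i - y j‖ := fun i j hij => sepDist_le_norm_sub hyinj hij
  have hqD : q ≤ D := by
    have hij : (⟨0, by omega⟩ : Fin n) ≠ ⟨1, by omega⟩ := by simp
    refine (hsep _ _ hij).trans ?_
    rw [← dist_eq_norm]
    exact hD (x _).2 (x _).2
  have hπ : 0 < (2 * π) ^ ((d : ℝ) / 2) := by positivity
  have hA := hk.quadForm_eq hΦ hτ x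
  have hAσ := hkσ.quadForm_eq hΦσ hστ x
  have hApos : ∀ α : Fin n → ℝ, α ≠ 0 → 0 < α ⬝ᵥ (k.matrix x *ᵥ α) := fun α hα => by
    rw [hA]
    refine mul_pos hπ (lt_of_lt_of_le ?_ (hlower q hq hqD n y hsep α))
    obtain ⟨i, hi⟩ := Function.ne_iff.mp hα
    have : 0 < ∑ i, α i ^ 2 := Finset.sum_pos' (fun i _ => sq_nonneg _)
      ⟨i, Finset.mem_univ i, by have : α i ≠ 0 := hi; positivity⟩
    positivity
  have hlow : ∀ α : Fin n → ℝ, α ⬝ᵥ (k.matrix x *ᵥ α) ≤ α ⬝ᵥ (kσ.matrix x *ᵥ α) := fun α => by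
    rw [hA, hAσ]
    refine mul_le_mul_of_nonneg_left (integral_mono
      ((integrable_besselWeight (by rwa [finrank_euclideanSpace_fin])).mul_norm_trigSum_sq _ _)
      ((integrable_besselWeight (by rwa [finrank_euclideanSpace_fin])).mul_norm_trigSum_sq _ _)
      fun ξ => ?_) hπ.le
    refine mul_le_mul_of_nonneg_right ?_ (sq_nonneg _)
    exact rpow_le_rpow_of_exponent_le (by nlinarith [sq_nonneg (2 * π * ‖ξ‖)]) (neg_le_neg hle)
  set Q := q ^ (-(1 - σ) * (2 * τ)) with hQ
  have hQpos : 0 < Q := by positivity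
  have hup : ∀ α : Fin n → ℝ,
      α ⬝ᵥ (kσ.matrix x *ᵥ α) ≤ c' * Q * (α ⬝ᵥ (k.matrix x *ᵥ α)) := fun α => by
    have h := hupper q hq hqD n y hsep α
    rw [show -(2 * (τ - σ * τ)) = -(1 - σ) * (2 * τ) by ring, ← hQ] at h
    rw [hA, hAσ]
    calc _ ≤ _ := mul_le_mul_of_nonneg_left h hπ.le
      _ = _ := by ring
  have hA'pos : ∀ α : Fin n → ℝ, α ≠ 0 → 0 < α ⬝ᵥ (k'.matrix x *ᵥ α) := fun α hα =>
    pos_of_mul_pos_right ((hApos α hα).trans_le (hkk.quadForm_ge hC x α)) (sq_nonneg C)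
  have hlow' : ∀ α : Fin n → ℝ, C₁ ^ (-2 : ℤ) * C ^ (-2 : ℤ) * (α ⬝ᵥ (k'.matrix x *ᵥ α)) ≤
      α ⬝ᵥ (kσ'.matrix x *ᵥ α) := fun α => by
    -- The chain k' ≤ C² k ≤ C² kσ ≤ C² C₁² kσ' of quadratic forms.
    have h1 := (hkk.quadForm_le hC x α).trans (mul_le_mul_of_nonneg_left
      ((hlow α).trans (hkkσ.quadForm_ge hC₁ x α)) (sq_nonneg C))
    rw [_root_.zpow_neg, _root_.zpow_neg, ← mul_inv, inv_mul_le_iff₀ (by positivity)]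
    norm_cast
    linarith
  have hup' : ∀ α : Fin n → ℝ, α ⬝ᵥ (kσ'.matrix x *ᵥ α) ≤
      C₁ ^ 2 * C ^ 2 * c' * Q * (α ⬝ᵥ (k'.matrix x *ᵥ α)) := fun α => by
    calc _ ≤ C₁ ^ 2 * (c' * Q * (C ^ 2 * (α ⬝ᵥ (k'.matrix x *ᵥ α)))) := by
          refine (hkkσ.quadForm_le hC₁ x α).trans (mul_le_mul_of_nonneg_left
            ((hup α).trans (mul_le_mul_of_nonneg_left (hkk.quadForm_ge hC x α) ?_)) ?_)
          all_goals positivity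
      _ = _ := by ring
  refine ⟨hA'pos, ?_, fun i => ⟨?_, ?_⟩⟩
  · obtain ⟨m, M, hm, hM⟩ := exists_isLeast_isGreatest_rayleighQuotients (by omega : 0 < n)
      (kσ'.matrix x) (k'.matrix x) hA'pos
    refine ⟨m, M, hm, hM, ?_, hm.2 hM.1, ?_⟩
    · obtain ⟨α, hα, rfl⟩ := hm.1
      exact (le_div_iff₀ (hA'pos α hα)).mpr (hlow' α)
    · obtain ⟨α, hα, rfl⟩ := hM.1
      exact (div_le_iff₀ (hA'pos α hα)).mpr (hup' α)
  · have := (k'.isHermitian_matrix x).mul_eigenvalues₀_le (kσ'.isHermitian_matrix x)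
      (a := C₁ ^ (-2 : ℤ) * C ^ (-2 : ℤ)) (b := 1) (by positivity) zero_le_one
      (fun v => by rw [one_mul]; exact hlow' v)
      -- Reversing the order affects both matrices alike, so the decreasing comparison applies at
      -- the reversed index.
      (Fin.cast (Fintype.card_fin n).symm i.rev)
    rwa [one_mul] at this
  · have := (kσ'.isHermitian_matrix x).mul_eigenvalues₀_le (k'.isHermitian_matrix x)
      (a := 1) (b := C₁ ^ 2 * C ^ 2 * c' * Q) zero_le_one (by positivity)
      (fun v => by rw [one_mul]; exact hup' v)
      (Fin.cast (Fintype.card_fin n).symm i.rev)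
    rwa [one_mul] at this

end
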